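/- **Definitions.** A *dynamic stream* for $\mathbb Z^n$ is a finite sequence of updates $\mathrm{Add}(i)$, $\mathrm{Remove}(i)$, $i\in[n]$; its *frequency vector* $x\in\mathbb Z^n$ starts at $0$ and each update adds $1$ to, respectively subtracts $1$ from, $x_i$. A *randomized streaming algorithm* $\mathcal A$ for $\mathbb Z^n$ is a Turing machine with a read-only one-way input tape holding the stream, a two-way working tape that is initially empty and, after each update, holds a string $w\in\{0,1\}^*$, and a read-only two-way random tape $\rho$ of uniformly random bits. For each update the machine begins in a distinguished state with its heads on the first cells of the working and random tapes, and it processes the update until it reaches a distinguished halting state; we require that every stream is processed. The output after the stream is $\mathrm{Dec}_{\mathcal A}(w,\rho)\in\{0,1\}$ for some function $\mathrm{Dec}_{\mathcal A}$ of the final working tape $w$ and the random tape. The randomness complexity is finite: for each $m$ there is $r(m)\in\mathbb N$ such that on all streams, of any length, with final frequency vector in $\{-m,\dots,m\}^n$, the final working tape and the output are determined by the first $r(m)$ random bits. $\mathcal A$ *computes* a partial function $g:\mathbb Z^n\to\{0,1,*\}$ with error probability at most $\delta$ if for every stream with final frequency vector $x$, the probability over $\rho$ that $g(x)\in\{0,1\}$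 and the output differs from $g(x)$ is at most $\delta$. Let $\mathcal S^+(\mathcal A,m)=\log_2|\mathcal W^+(\mathcal A,m)|$, where $\mathcal W^+(\mathcal A,m)$ is the set of all final working tapes that result from any stream with final frequency vector in $\{0,\dots,m\}^n$ and any random tape ($\mathcal S^+=\infty$ if this set is infinite). Finally, $g$ is *scale-invariant* if $g(ax)=g(x)$ for all $x\in\mathbb Z^n$ and all integers $a\ge 1$. **Theorem.** There is an absolute constant $C>0$ such that the following holds for all $n\ge 0$ (with $0^0=1$). Let $g:\mathbb Z^n\to\{0,1,*\}$ be scale-invariant, let $\mathcal A$ be a randomized streaming algorithm for $\mathbb Z^n$ that computes $g$ with error probability at most $\delta$, and let $\mathcal D$ be any probability distribution supported on $g^{-1}(\{0,1\})\subseteq\mathbb Z^n$. Then there are an integer $s\ge 0$ with $s\le \mathcal S^+(\mathcal A,1)$, a matrix $T\in\mathbb Z^{s\times n}$ with $\|T\|_\infty=\max_{i,j}|T_{ij}|\le C\,n^{n/2}$, and a function $\mathrm{Dec}:\mathbb Z^s\to\{0,1\}$ such that $$\Pr_{x\sim\mathcal D}\bigl[\mathrm{Dec}(Tx)=g(x)\bigr]\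 \ge\ 1-C\delta .$$ In particular, the bounds on the dimension and on the entries of $T$ do not depend on the magnitudes of the vectors in the support of $\mathcal D$. -/

import Mathlib

/-! ### Dynamic streams -/

/-- An update of a frequency vector indexed by `[n]`. -/
inductive StreamUpdate (n : ℕ) where
  | add (i : Fin n)
  | remove (i : Fin n)

/-- The change of the frequency vector that an update causes. -/
def StreamUpdate.vec {n : ℕ} : StreamUpdate n → (Fin n → ℤ)
  | .add i => Pi.single i 1
  | .remove i => -Pi.single i 1

/-- A dynamic stream for `ℤⁿ`; the head of the list is the first update. -/
abbrev DynamicStream (n : ℕ) := List (StreamUpdate n)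

/-- The final frequency vector of a stream. -/
def DynamicStream.freq {n : ℕ} (σ : DynamicStream n) : Fin n → ℤ :=
  (σ.map StreamUpdate.vec).sum

/-! ### Turing machines that process one update at a time -/

/-- Moves of a two-way head. -/
inductive HeadMove where
  | left
  | stay
  | right

/-- The displacement of a head. -/
def HeadMove.toInt : HeadMove → ℤ
  | .left => -1
  | .stay => 0
  | .right => 1

/-- What a machine does in one step. -/
structure StreamAction (Q : Type) where
  /-- the next state -/
  state : Q
  /-- the symbol written on the scanned cell of the working tape (`none` is the blank) -/
  write : Option Bool
  /-- the move of the head of the working tape -/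
  workMove : HeadMove
  /-- the move of the head of the random tape -/
  randMove : HeadMove

/-- A Turing machine with distinguished states `start` and `halt` (begin and end of the processing
of an update).  In one step it sees its state, the current update on the (read-only, one-way) input
tape, the scanned symbol of the working tape and the scanned symbol of the (read-only) random tape;
`none` is the blank symbol. -/
structure StreamMachine (n : ℕ) where
  /-- the state space -/
  State : Type
  /-- the state space is finite -/
  finite_state : Finite State
  /-- the state in which the processing of an update begins -/
  start : State
  /-- the state in which the processing of an update ends -/
  halt : State
  /-- the transition table -/
  table : State → StreamUpdate n → Option Bool → Option Bool → StreamAction State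

/-- The content of the cells of a working tape that stores the string `w` in cells `0, 1, …`. -/
def workTape (w : List Bool) : ℤ → Option Bool
  | Int.ofNat k => w[k]?
  | Int.negSucc _ => none

/-- The content of the cells of a random tape that stores the bits `ω 0, ω 1, …` in cells
`0, 1, …`. -/
def randTape (ω : ℕ → Bool) : ℤ → Option Bool
  | Int.ofNat k => some (ω k)
  | Int.negSucc _ => none

namespace StreamMachine

variable {n : ℕ}

/-- A snapshot of the machine while it processes an update. -/
structure Snapshot (M : StreamMachine n) where
  /-- the current state -/
  state : M.State
  /-- the content of the working tape -/
  work : ℤ → Option Bool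
  /-- the position of the head of the working tape -/
  workHead : ℤ
  /-- the position of the head of the random tape -/
  randHead : ℤ

/-- The snapshot at the beginning of the processing of an update with working tape `w`. -/
def initial (M : StreamMachine n) (w : List Bool) : M.Snapshot :=
  ⟨M.start, workTape w, 0, 0⟩

open Classical in
/-- One step of the machine on update `u` with random tape `ω`; the state `halt` is halting. -/
noncomputable def step (M : StreamMachine n) (ω : ℕ → Bool) (u : StreamUpdate n)
    (c : M.Snapshot) : M.Snapshot :=
  if c.state = M.halt then c
  else
    let a := M.table c.state u (c.work c.workHead) (randTape ω c.randHead)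
    ⟨a.state, Function.update c.work c.workHead a.write,
      c.workHead + a.workMove.toInt, c.randHead + a.randMove.toInt⟩

/-- `w ⊕ u = w'` with random tape `ω`: started with working tape `w`, the machine reaches the state
`halt` with working tape `w'`. -/
def Transition (M : StreamMachine n) (ω : ℕ → Bool) (u : StreamUpdate n)
    (w w' : List Bool) : Prop :=
  ∃ k : ℕ, ((M.step ω u)^[k] (M.initial w)).state = M.halt ∧
    ((M.step ω u)^[k] (M.initial w)).work = workTape w'

/-- `M.Processes ω w σ w'`: started with working tape `w`, and with random tape `ω`, the machine
processes all updates of `σ`, one after the other, and ends with working tape `w'`. -/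
inductive Processes (M : StreamMachine n) (ω : ℕ → Bool) :
    List Bool → DynamicStream n → List Bool → Prop
  | nil (w : List Bool) : Processes M ω w [] w
  | cons {w w₁ w' : List Bool} {u : StreamUpdate n} {σ : DynamicStream n} :
      M.Transition ω u w w₁ → Processes M ω w₁ σ w' → Processes M ω w (u :: σ) w'

end StreamMachine

/-! ### Randomized streaming algorithms -/

/-- A randomized streaming algorithm for streams over `[n]`: a machine that, from the empty working
tape, processes every stream, an output function of the final working tape and the random tape,
and a randomness complexity `r`: on streams with final frequency vector in `{-m, …, m}ⁿ` the final
working tape and the output are determined by the first `r m` random bits, whatever the length of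
the stream. -/
structure StreamingAlgorithm (n : ℕ) where
  /-- the machine -/
  machine : StreamMachine n
  /-- the output function -/
  dec : List Bool → (ℕ → Bool) → Bool
  /-- the randomness complexity -/
  r : ℕ → ℕ
  /-- every stream is processed, for every content of the random tape -/
  total : ∀ (ω : ℕ → Bool) (σ : DynamicStream n), ∃ w, machine.Processes ω [] σ w
  /-- at most `r m` random bits matter on streams with final frequency vector in `{-m, …, m}ⁿ` -/
  finite_randomness : ∀ (m : ℕ) (σ : DynamicStream n), (∀ i, |σ.freq i| ≤ (m : ℤ)) →
    ∀ ω ω' : ℕ → Bool, (∀ k < r m, ω k = ω' k) → ∀ w, machine.Processes ω [] σ w →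
      machine.Processes ω' [] σ w ∧ dec w ω = dec w ω'

/-- The random tape that holds the string `ρ`; the cells behind it hold `0`. -/
def padTape {r : ℕ} (ρ : Fin r → Bool) (k : ℕ) : Bool :=
  if h : k < r then ρ ⟨k, h⟩ else false

namespace StreamingAlgorithm

variable {n : ℕ}

/-- The final working tape after processing the stream `σ` with random tape `ω`. -/
noncomputable def finalTape (A : StreamingAlgorithm n) (ω : ℕ → Bool)
    (σ : DynamicStream n) : List Bool :=
  (A.total ω σ).choose

/-- The output on the stream `σ` with random tape `ω`. -/
noncomputable def output (A : StreamingAlgorithm n) (ω : ℕ → Bool) (σ : DynamicStream n) : Bool :=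
  A.dec (A.finalTape ω σ) ω

/-- `A` computes the partial function `g` (`none` stands for `*`) with error probability at most
`δ`: on every stream with final frequency vector `x ∈ {-m, …, m}ⁿ`, the probability over a uniformly
random `ρ ∈ {0,1}^(r m)` that `g x ∈ {0,1}` and the output differs from `g x` is at most `δ`. -/
def Computes (A : StreamingAlgorithm n) (g : (Fin n → ℤ) → Option Bool) (δ : ℝ) : Prop :=
  ∀ (m : ℕ) (σ : DynamicStream n), (∀ i, |σ.freq i| ≤ (m : ℤ)) →
    (PMF.uniformOfFintype (Fin (A.r m) → Bool)).toMeasure.real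
      {ρ | g σ.freq ≠ none ∧ some (A.output (padTape ρ) σ) ≠ g σ.freq} ≤ δ

/-- The set of all final working tapes that result from streams with final frequency vector in
`{0, …, m}ⁿ` and any content of the random tape. -/
def finalTapes (A : StreamingAlgorithm n) (m : ℕ) : Set (List Bool) :=
  {w | ∃ (σ : DynamicStream n) (ρ : Fin (A.r m) → Bool),
    (∀ i, 0 ≤ σ.freq i ∧ σ.freq i ≤ (m : ℤ)) ∧ w = A.finalTape (padTape ρ) σ}

open Classical in
/-- The space complexity on nonnegative frequency vectors: the base-2 logarithm of the number of
final working tapes (`⊤` if there are infinitely many). -/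
noncomputable def space (A : StreamingAlgorithm n) (m : ℕ) : EReal :=
  if (A.finalTapes m).Finite then ((Real.logb 2 ((A.finalTapes m).ncard : ℝ) : ℝ) : EReal) else ⊤

end StreamingAlgorithm

/-- A partial function `g : ℤⁿ → {0, 1, *}` is scale-invariant if `g (a x) = g x` for all positive
integers `a`. -/
def ScaleInvariant {n : ℕ} (g : (Fin n → ℤ) → Option Bool) : Prop :=
  ∀ (a : ℤ), 0 < a → ∀ x : Fin n → ℤ, g (a • x) = g x

/-!
Fix the random tape. The final tape of a stream is then a right congruence: it determines the final
tape of every extension. Since the streams with frequency vector `0` end in finitely many tapes,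
there is a zero-frequency stream `γ` whose state is recurrent, that is, whatever a zero-frequency
stream does to it can be undone by another one (`exists_isRecurrent`). The frequency vectors of the
streams that lead from `γ` back to the state of `γ` form a subgroup `K` of `ℤⁿ`, and the states
behind `γ` with a given frequency vector modulo `K` form one class under zero-frequency streams
(`exists_zero_freq_of_sub_mem`), while distinct classes are disjoint (`sub_mem_loopGroup`).

Let `S` be the set of vectors of `K` with entries in `{-1, 0, 1}`. The equations of its rational
span can be written with minors of vectors of `S` as coefficients, and these are at most `n^(n/2)`
by Hadamard's inequality; this gives a matrix `T` that vanishes on `S` and whose kernel is mapped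
into `K` by the factor `(n!)!` (`exists_small_matrix_ker_eq_span`). With `s` rows, `T` is injective
on the `0/1`-vectors supported on `s` coordinates, so these end in `2^s` different final tapes, and
`s ≤ 𝒮⁺(𝒜, 1)` (`StreamingAlgorithm.exists_sketch_matrix`).

If `T x = T y`, the multiples `a x` and `a y`, `a = (n!)!`, hence end in the same class, but the
states within the class may differ, and the stream that represents `a x` must not depend on the
random tape, because the error bound holds for each stream on average over the tapes. For finitely
many tapes at once, Doeblin's argument yields a random zero-frequency stream that makes the
(finite) recurrent class of `γ` forget its initial state (`exists_mixing_stream`). The class of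
`a x` need not be finite, and is mixed by a detour: append, for every `z` in a finite set of inputs,
the loop that subtracts `a z`, mixes, and adds `a z`. In the loop of `z = x`, both `x` and `y`
return to the class of `γ`, become indistinguishable, and continue in the same way
(`abs_average_loopStreams_sub_le`). So the acceptance probability is almost a function of the
sketch, and rounding it errs only where the algorithm errs with probability at least `1/4`.
Averaging over the tapes gives a tape that loses at most `4 δ` on a finite set of inputs of
probability at least `1 - δ`. If `δ = 0`, no mixing is needed and `g` itself is a function of the
sketch.
-/

/-! ### Frequency vectors of streams -/

namespace DynamicStream

variable {n : ℕ}

@[simp]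
theorem freq_nil : freq ([] : DynamicStream n) = 0 := rfl

@[simp]
theorem freq_append (σ τ : DynamicStream n) : freq (σ ++ τ) = freq σ + freq τ := by
  simp [freq]

theorem exists_freq_eq (x : Fin n → ℤ) : ∃ σ : DynamicStream n, freq σ = x := by
  let P : AddSubmonoid (Fin n → ℤ) :=
    { carrier := Set.range freq
      zero_mem' := ⟨[], rfl⟩
      add_mem' := by
        rintro _ _ ⟨σ, rfl⟩ ⟨τ, rfl⟩
        exact ⟨σ ++ τ, freq_append σ τ⟩ }
  have hadd (i : Fin n) : Pi.single i (1 : ℤ) ∈ P := ⟨[.add i], by simp [freq, StreamUpdate.vec]⟩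
  have hrem (i : Fin n) : -Pi.single i (1 : ℤ) ∈ P :=
    ⟨[.remove i], by simp [freq, StreamUpdate.vec]⟩
  have hsingle (i : Fin n) (k : ℤ) : Pi.single i k ∈ P := by
    obtain ⟨m, rfl | rfl⟩ := k.eq_nat_or_neg
    · have h := P.nsmul_mem (hadd i) m
      rwa [← Pi.single_smul, nsmul_one] at h
    · have h := P.nsmul_mem (hrem i) m
      rwa [smul_neg, ← Pi.single_smul, nsmul_one, ← Pi.single_neg] at h
  have hx : x ∈ P := by
    rw [← Finset.univ_sum_single x]
    exact P.sum_mem fun i _ => hsingle i (x i)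
  exact hx

/-- A stream with a given frequency vector. -/
noncomputable def ofFreq (x : Fin n → ℤ) : DynamicStream n := (exists_freq_eq x).choose

@[simp]
theorem freq_ofFreq (x : Fin n → ℤ) : freq (ofFreq x) = x := (exists_freq_eq x).choose_spec

end DynamicStream

open DynamicStream

/-! ### Final working tapes -/

theorem workTape_injective : Function.Injective workTape := by
  intro w w' h
  refine List.ext_getElem? fun k => ?_
  exact congrFun h (Int.ofNat k)

namespace StreamMachine

variable {n : ℕ} {M : StreamMachine n} {ω : ℕ → Bool}

theorem iterate_step_of_halt {u : StreamUpdate n} {c : M.Snapshot} (h : c.state = M.halt)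
    (k : ℕ) : (M.step ω u)^[k] c = c :=
  Function.iterate_fixed (by simp [step, h]) k

theorem Transition.unique {u : StreamUpdate n} {w w₁ w₂ : List Bool}
    (h₁ : M.Transition ω u w w₁) (h₂ : M.Transition ω u w w₂) : w₁ = w₂ := by
  obtain ⟨k, hk, hkw⟩ := h₁
  obtain ⟨l, hl, hlw⟩ := h₂
  apply workTape_injective
  rw [← hkw, ← hlw]
  rcases le_total k l with hkl | hkl
  · obtain ⟨d, rfl⟩ := Nat.exists_eq_add_of_le' hkl
    rw [Function.iterate_add_apply, iterate_step_of_halt hk]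
  · obtain ⟨d, rfl⟩ := Nat.exists_eq_add_of_le' hkl
    rw [Function.iterate_add_apply, iterate_step_of_halt hl]

theorem Processes.unique {w w₁ w₂ : List Bool} {σ : DynamicStream n}
    (h₁ : M.Processes ω w σ w₁) (h₂ : M.Processes ω w σ w₂) : w₁ = w₂ := by
  induction h₁ with
  | nil w => cases h₂; rfl
  | cons ht _ ih =>
    cases h₂ with
    | cons ht' hp' =>
      obtain rfl := ht.unique ht'
      exact ih hp'

theorem Processes.exists_of_append {w w' : List Bool} {σ τ : DynamicStream n}
    (h : M.Processes ω w (σ ++ τ) w') :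
    ∃ w₁, M.Processes ω w σ w₁ ∧ M.Processes ω w₁ τ w' := by
  induction σ generalizing w with
  | nil => exact ⟨w, .nil w, h⟩
  | cons u σ ih =>
    cases h with
    | cons ht hp =>
      obtain ⟨w₁, h₁, h₂⟩ := ih hp
      exact ⟨w₁, .cons ht h₁, h₂⟩

end StreamMachine

/-- A function on streams is a right congruence if its value after an extension of a stream depends
only on its value before; the final tape of a deterministic machine is the model case. -/
def IsRightCongruence {n : ℕ} {W : Type*} (st : DynamicStream n → W) : Prop :=
  ∀ ⦃σ σ' : DynamicStream n⦄, st σ = st σ' → ∀ τ, st (σ ++ τ) = st (σ' ++ τ)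

namespace StreamingAlgorithm

variable {n : ℕ} (A : StreamingAlgorithm n)

theorem processes_finalTape (ω : ℕ → Bool) (σ : DynamicStream n) :
    A.machine.Processes ω [] σ (A.finalTape ω σ) :=
  (A.total ω σ).choose_spec

theorem isRightCongruence_finalTape (ω : ℕ → Bool) : IsRightCongruence (A.finalTape ω) := by
  intro σ σ' h τ
  obtain ⟨w, hw, hw'⟩ := (A.processes_finalTape ω (σ ++ τ)).exists_of_append
  obtain ⟨v, hv, hv'⟩ := (A.processes_finalTape ω (σ' ++ τ)).exists_of_append
  obtain rfl : w = v := by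
    rw [hw.unique (A.processes_finalTape ω σ), h, hv.unique (A.processes_finalTape ω σ')]
  exact hw'.unique hv'

/-- The random bits behind the first `r m` do not influence the final tape, so `finalTapes` misses
no tape although it pads random strings with zeros. -/
theorem finalTape_mem_finalTapes {m : ℕ} (ω : ℕ → Bool) {σ : DynamicStream n}
    (hσ : ∀ i, 0 ≤ freq σ i ∧ freq σ i ≤ (m : ℤ)) : A.finalTape ω σ ∈ A.finalTapes m := by
  refine ⟨σ, fun k => ω k, hσ, ?_⟩
  have habs (i : Fin n) : |freq σ i| ≤ (m : ℤ) := by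
    rw [abs_of_nonneg (hσ i).1]
    exact (hσ i).2
  have hω : ∀ k < A.r m, ω k = padTape (fun j : Fin (A.r m) => ω j) k := by
    intro k hk
    simp [padTape, hk]
  exact (A.finite_randomness m σ habs ω _ hω _ (A.processes_finalTape ω σ)).1.unique
    (A.processes_finalTape _ σ)

theorem finite_range_finalTape (hfin : (A.finalTapes 1).Finite) (ω : ℕ → Bool) :
    {w | ∃ σ, freq σ = 0 ∧ A.finalTape ω σ = w}.Finite := by
  refine hfin.subset ?_
  rintro _ ⟨σ, hσ, rfl⟩
  exact A.finalTape_mem_finalTapes ω fun i => by simp [hσ]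

end StreamingAlgorithm

/-! ### Recurrent streams and their loops -/

section Recurrence

variable {n : ℕ} {W : Type*} {st : DynamicStream n → W} {γ : DynamicStream n}

/-- The state after `γ` is recurrent for zero-frequency streams: whatever such a stream does to it
can be undone by another one. -/
def IsRecurrent (st : DynamicStream n → W) (γ : DynamicStream n) : Prop :=
  ∀ τ, freq τ = 0 → ∃ τ', freq τ' = 0 ∧ st (γ ++ τ ++ τ') = st γ

/-- Finitely many right congruences have a common recurrent stream: one that minimizes the total
number of states that zero-frequency streams can still reach. -/
theorem exists_isRecurrent {ι : Type*} [Fintype ι] {st : ι → DynamicStream n → W}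
    (hfin : ∀ i, {w | ∃ σ, freq σ = 0 ∧ st i σ = w}.Finite) :
    ∃ γ, freq γ = 0 ∧ ∀ i, IsRecurrent (st i) γ := by
  let reach (i : ι) (γ : DynamicStream n) : Set W := {w | ∃ τ, freq τ = 0 ∧ st i (γ ++ τ) = w}
  have hreach_fin (i : ι) {γ : DynamicStream n} (hγ : freq γ = 0) : (reach i γ).Finite := by
    refine (hfin i).subset ?_
    rintro _ ⟨τ, hτ, rfl⟩
    exact ⟨γ ++ τ, by simp [hγ, hτ], rfl⟩
  let N (γ : {γ : DynamicStream n // freq γ = 0}) : ℕ := ∑ i, (reach i γ).ncard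
  have : Nonempty {γ : DynamicStream n // freq γ = 0} := ⟨⟨[], freq_nil⟩⟩
  let γ := Function.argmin N
  refine ⟨γ, γ.2, fun i τ hτ => ?_⟩
  have hγτ : freq (γ.1 ++ τ) = 0 := by simp [γ.2, hτ]
  have hsub (j : ι) : reach j (γ.1 ++ τ) ⊆ reach j γ.1 := by
    rintro _ ⟨τ', hτ', rfl⟩
    exact ⟨τ ++ τ', by simp [hτ, hτ'], by simp⟩
  have hle (j : ι) : (reach j (γ.1 ++ τ)).ncard ≤ (reach j γ.1).ncard :=
    Set.ncard_le_ncard (hsub j) (hreach_fin j γ.2)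
  have hmin : N γ ≤ N ⟨γ.1 ++ τ, hγτ⟩ :=
    Function.argmin_le N ⟨γ.1 ++ τ, hγτ⟩
  have heq : (reach i (γ.1 ++ τ)).ncard = (reach i γ.1).ncard :=
    (Finset.sum_eq_sum_iff_of_le fun j _ => hle j).1
      (le_antisymm (Finset.sum_le_sum fun j _ => hle j) hmin) i (Finset.mem_univ i)
  have hset := Set.eq_of_subset_of_ncard_le (hsub i) heq.ge (hreach_fin i γ.2)
  have hmem : st i γ.1 ∈ reach i γ.1 := ⟨[], freq_nil, by simp⟩
  rw [← hset] at hmem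
  exact hmem

/-- The frequency vectors of the streams that lead from the state after `γ` back to that state. -/
def loopGroup (hst : IsRightCongruence st) (hγ : IsRecurrent st γ) : AddSubgroup (Fin n → ℤ) where
  carrier := {k | ∃ β, freq β = k ∧ st (γ ++ β) = st γ}
  zero_mem' := ⟨[], rfl, by simp⟩
  add_mem' := by
    rintro _ _ ⟨β, rfl, hβ⟩ ⟨β', rfl, hβ'⟩
    refine ⟨β ++ β', freq_append β β', ?_⟩
    rw [← List.append_assoc, hst hβ, hβ']
  neg_mem' := by
    rintro _ ⟨β, rfl, hβ⟩
    obtain ⟨τ, hτ, h⟩ := hγ (β ++ ofFreq (-freq β)) (by simp)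
    refine ⟨ofFreq (-freq β) ++ τ, by simp [hτ], ?_⟩
    rw [← h, ← hst hβ]
    simp

theorem IsRecurrent.exists_return (hγ : IsRecurrent st γ) (β : DynamicStream n) :
    ∃ τ, freq τ = -freq β ∧ st (γ ++ β ++ τ) = st γ := by
  obtain ⟨τ, hτ, h⟩ := hγ (β ++ ofFreq (-freq β)) (by simp)
  exact ⟨ofFreq (-freq β) ++ τ, by simp [hτ], by simpa using h⟩

/-- The states behind `γ` with a given frequency vector modulo the loop group form a single class
under zero-frequency streams. -/
theorem exists_zero_freq_of_sub_mem (hst : IsRightCongruence st) (hγ : IsRecurrent st γ)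
    {β β' : DynamicStream n}
    (h : freq β - freq β' ∈ loopGroup hst hγ) :
    ∃ τ, freq τ = 0 ∧ st (γ ++ β ++ τ) = st (γ ++ β') := by
  obtain ⟨κ, hκ, hκst⟩ := h
  obtain ⟨τ, hτ, hτst⟩ := hγ.exists_return β
  refine ⟨τ ++ κ ++ β', by simp [hτ, hκ], ?_⟩
  have h₁ : st (γ ++ β ++ τ ++ κ) = st γ := by rw [hst hτst, hκst]
  simpa using hst h₁ β'

theorem sub_mem_loopGroup (hst : IsRightCongruence st) (hγ : IsRecurrent st γ)
    {β β' : DynamicStream n} (h : st (γ ++ β) = st (γ ++ β')) :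
    freq β - freq β' ∈ loopGroup hst hγ := by
  obtain ⟨τ, hτ, hτst⟩ := hγ.exists_return β'
  refine ⟨β ++ τ, by simp [hτ, sub_eq_add_neg], ?_⟩
  rw [← hτst, ← hst h]
  simp

end Recurrence

/-! ### Bordered minors and Hadamard's inequality -/

/-- Hadamard's inequality for integer matrices with entries in `{-1, 0, 1}`: up to sign, the
determinant is the volume form of `ℝᵏ` at the rows, which have norm at most `√k`. -/
theorem abs_det_le_rpow_of_abs_le_one {k : ℕ} (A : Matrix (Fin k) (Fin k) ℤ)
    (hA : ∀ i j, |A i j| ≤ 1) : |(A.det : ℝ)| ≤ (k : ℝ) ^ ((k : ℝ) / 2) := by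
  let b := EuclideanSpace.basisFun (Fin k) ℝ
  have : Fact (Module.finrank ℝ (EuclideanSpace ℝ (Fin k)) = k) := ⟨by simp⟩
  let v (i : Fin k) : EuclideanSpace ℝ (Fin k) := WithLp.toLp 2 fun j => (A i j : ℝ)
  have hdet : b.toBasis.det v = (A.det : ℝ) := by
    rw [Module.Basis.det_apply, Int.cast_det, ← Matrix.det_transpose]
    congr 1
  have hnorm (i : Fin k) : ‖v i‖ ≤ √k := by
    rw [EuclideanSpace.norm_eq]
    refine Real.sqrt_le_sqrt ?_
    calc ∑ j, ‖v i j‖ ^ 2 ≤ ∑ _j : Fin k, (1 : ℝ) := by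
          refine Finset.sum_le_sum fun j _ => ?_
          have h : |(A i j : ℝ)| ≤ 1 := by exact_mod_cast hA i j
          simpa [v] using h
      _ = k := by simp
  calc |(A.det : ℝ)| = |b.toBasis.orientation.volumeForm v| := by
        rw [Orientation.volumeForm_robust' _ b, hdet]
    _ ≤ ∏ i, ‖v i‖ := Orientation.abs_volumeForm_apply_le _ v
    _ ≤ ∏ _i : Fin k, √(k : ℝ) := Finset.prod_le_prod (fun i _ => norm_nonneg _) fun i _ => hnorm i
    _ = (k : ℝ) ^ ((k : ℝ) / 2) := by
        rw [Finset.prod_const, Finset.card_univ, Fintype.card_fin, Real.sqrt_eq_rpow,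
          ← Real.rpow_natCast, ← Real.rpow_mul (Nat.cast_nonneg k)]
        congr 1
        ring

theorem rpow_half_self_le_rpow_half_self {k n : ℕ} (h : k ≤ n) :
    (k : ℝ) ^ ((k : ℝ) / 2) ≤ (n : ℝ) ^ ((n : ℝ) / 2) := by
  rcases Nat.eq_zero_or_pos k with rfl | hk
  · rcases Nat.eq_zero_or_pos n with rfl | hn
    · simp
    · simpa using Real.one_le_rpow (by exact_mod_cast hn : (1 : ℝ) ≤ n) (by positivity)
  · have hk' : (1 : ℝ) ≤ k := by exact_mod_cast hk
    have hkn : (k : ℝ) ≤ n := by exact_mod_cast h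
    calc (k : ℝ) ^ ((k : ℝ) / 2) ≤ (n : ℝ) ^ ((k : ℝ) / 2) :=
          Real.rpow_le_rpow (by positivity) hkn (by positivity)
      _ ≤ (n : ℝ) ^ ((n : ℝ) / 2) :=
          Real.rpow_le_rpow_of_exponent_le (hk'.trans hkn) (by linarith)

/-- If the matrix `A` bordered by the column `b`, the row `c` and the corner `t` is singular and `A`
is not, then the Schur complement `t - c A⁻¹ b`, multiplied by `det A`, vanishes. -/
theorem det_mul_corner_eq_of_det_bordered_eq_zero {m : Type*} [Fintype m] [DecidableEq m]
    {A : Matrix m m ℤ} {b c : m → ℤ} {t : ℤ} (hA : A.det ≠ 0)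
    (h : (Matrix.fromBlocks A (Matrix.replicateCol Unit b) (Matrix.replicateRow Unit c)
      (Matrix.of fun _ _ => t)).det = 0) :
    A.det * t = c ⬝ᵥ A.cramer b := by
  obtain ⟨v, hv, hMv⟩ := Matrix.exists_mulVec_eq_zero_iff.2 h
  have hrow (i : m) : (A.mulVec (v ∘ Sum.inl)) i + b i * v (Sum.inr ()) = 0 := by
    have := congrFun hMv (Sum.inl i)
    rw [Matrix.fromBlocks_mulVec] at this
    simpa [Matrix.mulVec, dotProduct] using this
  have hlast : c ⬝ᵥ (v ∘ Sum.inl) + t * v (Sum.inr ()) = 0 := by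
    have := congrFun hMv (Sum.inr ())
    rw [Matrix.fromBlocks_mulVec] at this
    simpa [Matrix.mulVec, dotProduct] using this
  set x := v ∘ Sum.inl with hx
  set y := v (Sum.inr ()) with hy
  have hAx : A.mulVec x = -(y • b) := by
    ext i
    have := hrow i
    simp only [Pi.neg_apply, Pi.smul_apply, smul_eq_mul]
    linarith
  have hdx : A.det • x = -(y • A.cramer b) := by
    have : A.adjugate.mulVec (A.mulVec x) = A.det • x := by
      rw [Matrix.mulVec_mulVec, Matrix.adjugate_mul, Matrix.smul_mulVec, Matrix.one_mulVec]
    rw [← this, hAx, Matrix.cramer_eq_adjugate_mulVec, Matrix.mulVec_neg, Matrix.mulVec_smul]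
  have hy0 : y ≠ 0 := by
    intro hy0
    refine hv ?_
    have hx0 : x = 0 := by
      rw [hy0, zero_smul, neg_zero] at hdx
      exact (smul_eq_zero.1 hdx).resolve_left hA
    ext (i | i)
    · exact congrFun hx0 i
    · exact hy0
  have hc : A.det * (c ⬝ᵥ x) = -(y * (c ⬝ᵥ A.cramer b)) := by
    have := congrArg (c ⬝ᵥ ·) hdx
    rwa [dotProduct_smul, smul_eq_mul, dotProduct_neg, dotProduct_smul, smul_eq_mul] at this
  refine mul_left_cancel₀ hy0 ?_
  linear_combination A.det * hlast - hc

/-- A set of integer vectors with entries in `{-1, 0, 1}` has the kernel of a small matrix `T` as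
its rational span, up to a bounded factor `d`.  The rows of `T` are the minors of maximal size of
vectors of `S`, bordered by one more column and by a row of indeterminates, so that their entries
are minors of vectors of `S`; on the coordinates `e` outside the maximal minor, `T` is `±d` times
the identity. -/
theorem exists_small_matrix_ker_eq_span {n : ℕ} {S : Set (Fin n → ℤ)}
    (hS : ∀ v ∈ S, ∀ i, |v i| ≤ 1) :
    ∃ (s : ℕ) (T : Matrix (Fin s) (Fin n) ℤ) (e : Fin s → Fin n) (c : ℤ) (d : ℕ),
      0 < d ∧ d ≤ n.factorial ∧ c ≠ 0 ∧ Function.Injective e ∧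
      (∀ i j, |(T i j : ℝ)| ≤ (n : ℝ) ^ ((n : ℝ) / 2)) ∧
      (∀ v ∈ S, T.mulVec v = 0) ∧
      (∀ x, T.mulVec x = 0 → (d : ℤ) • x ∈ AddSubgroup.closure S) ∧
      ∀ i j, T i (e j) = if i = j then c else 0 := by
  classical
  -- The size of the largest nonvanishing minor of vectors of `S`.
  let Q (k : ℕ) : Prop := ∃ (B : Fin k → Fin n → ℤ) (J : Fin k → Fin n),
    (∀ a, B a ∈ S) ∧ (Matrix.of fun a b => B a (J b)).det ≠ 0
  have hinj {k : ℕ} {B : Fin k → Fin n → ℤ} {J : Fin k → Fin n}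
      (h : (Matrix.of fun a b => B a (J b)).det ≠ 0) : Function.Injective J := by
    intro b b' hbb
    by_contra hne
    exact h (Matrix.det_zero_of_column_eq hne fun a => by simp [hbb])
  have hQle {k : ℕ} (hk : Q k) : k ≤ n := by
    obtain ⟨B, J, -, h⟩ := hk
    simpa using Fintype.card_le_of_injective J (hinj h)
  have hQ0 : Q 0 := ⟨fun a => a.elim0, fun a => a.elim0, fun a => a.elim0, by simp⟩
  obtain ⟨k, hk, hkmax⟩ : ∃ k, Q k ∧ ¬ Q (k + 1) := by
    by_contra! hcon
    have hall (k : ℕ) : Q k := by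
      induction k with
      | zero => exact hQ0
      | succ k ih => exact hcon k ih
    exact absurd (hQle (hall (n + 1))) (by omega)
  have hkn := hQle hk
  obtain ⟨B, J, hBS, hdet⟩ := hk
  have hJ := hinj hdet
  set A : Matrix (Fin k) (Fin k) ℤ := Matrix.of fun a b => B a (J b) with hAdef
  have hA1 (a b : Fin k) : |A a b| ≤ 1 := hS _ (hBS a) _
  have hcramer1 (i : Fin n) (b : Fin k) :
      |(A.cramer (fun a => B a i) b : ℝ)| ≤ (n : ℝ) ^ ((n : ℝ) / 2) := by
    rw [Matrix.cramer_apply]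
    refine (abs_det_le_rpow_of_abs_le_one _ fun a b' => ?_).trans
      (rpow_half_self_le_rpow_half_self hkn)
    rw [Matrix.updateCol_apply]
    split_ifs
    · exact hS _ (hBS a) _
    · exact hA1 a b'
  let I := {i : Fin n // i ∉ Set.range J}
  let f : Fin (Fintype.card I) ≃ I := (Fintype.equivFin I).symm
  let T : Matrix (Fin (Fintype.card I)) (Fin n) ℤ := fun i j =>
    (if j = f i then A.det else 0) - ∑ b, if J b = j then A.cramer (fun a => B a (f i)) b else 0
  have hTmul (x : Fin n → ℤ) (i) :
      T.mulVec x i = A.det * x (f i) - (fun b => x (J b)) ⬝ᵥ A.cramer fun a => B a (f i) := by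
    simp only [Matrix.mulVec, dotProduct, T, sub_mul, Finset.sum_sub_distrib, ite_mul, zero_mul,
      Finset.sum_ite_eq', Finset.mem_univ, if_true, Finset.sum_mul]
    rw [Finset.sum_comm]
    simp [mul_comm]
  have hTJ (i b) : T i (J b) = -A.cramer (fun a => B a (f i)) b := by
    have h : J b ≠ (f i).1 := fun h => (f i).2 ⟨b, h⟩
    simp [T, h, hJ.eq_iff]
  have hTI (i) {j : Fin n} (hj : j ∉ Set.range J) : T i j = if j = f i then A.det else 0 := by
    have h (b : Fin k) : J b ≠ j := fun h => hj ⟨b, h⟩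
    simp [T, h]
  refine ⟨_, T, fun i => f i, A.det, A.det.natAbs, Int.natAbs_pos.2 hdet, ?_, hdet,
    Subtype.val_injective.comp f.injective, ?_, ?_, ?_, ?_⟩
  · have h := Matrix.det_le (A := A) (abv := AbsoluteValue.abs) (x := 1) hA1
    simp only [Fintype.card_fin, one_pow, nsmul_eq_mul, mul_one] at h
    have h' : A.det.natAbs ≤ k.factorial := by
      zify
      exact h
    exact h'.trans (Nat.factorial_le hkn)
  · intro i j
    by_cases hj : j ∈ Set.range J
    · obtain ⟨b, rfl⟩ := hj
      rw [hTJ]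
      simpa using hcramer1 (f i) b
    · rw [hTI i hj]
      split_ifs
      · exact (abs_det_le_rpow_of_abs_le_one A hA1).trans (rpow_half_self_le_rpow_half_self hkn)
      · simpa using Real.rpow_nonneg (Nat.cast_nonneg n) _
  · intro v hv
    ext i
    rw [hTmul, Pi.zero_apply, sub_eq_zero]
    refine det_mul_corner_eq_of_det_bordered_eq_zero hdet ?_
    -- A nonzero bordered minor would be a larger nonvanishing minor of vectors of `S`.
    by_contra hne
    let g : Fin (k + 1) ≃ Fin k ⊕ Unit := Fintype.equivOfCardEq (by simp)
    refine hkmax ⟨fun a => Sum.elim B (fun _ => v) (g a),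
      fun b => Sum.elim J (fun _ => (f i).1) (g b), fun a => ?_, ?_⟩
    · dsimp only
      rcases g a with a' | a'
      · exact hBS a'
      · exact hv
    · rw [← Matrix.det_submatrix_equiv_self g] at hne
      convert hne using 2
      ext a b
      rcases hga : g a with a' | a' <;> rcases hgb : g b with b' | b' <;>
        simp [hga, hgb, A, Matrix.submatrix_apply]
  · intro x hx
    -- The coefficients of `det A • x` in the rows `B` solve the equations of the columns `J`.
    let y : Fin k → ℤ := Matrix.vecMul (fun b => x (J b)) A.adjugate
    have hy (i : Fin n) : A.det * x i = y ⬝ᵥ fun a => B a i := by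
      by_cases hi : i ∈ Set.range J
      · obtain ⟨b, rfl⟩ := hi
        have h : Matrix.vecMul y A = A.det • fun b => x (J b) := by
          rw [Matrix.vecMul_vecMul, Matrix.adjugate_mul, Matrix.vecMul_smul, Matrix.vecMul_one]
        exact (congrFun h b).symm
      · have h := congrFun hx (f.symm ⟨i, hi⟩)
        rw [hTmul, Pi.zero_apply, sub_eq_zero, Equiv.apply_symm_apply] at h
        rw [h, Matrix.cramer_eq_adjugate_mulVec, Matrix.dotProduct_mulVec]
    have hmem : A.det • x ∈ AddSubgroup.closure S := by
      have hsum : A.det • x = ∑ a, y a • B a := by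
        ext i
        simpa [dotProduct] using hy i
      rw [hsum]
      exact AddSubgroup.sum_mem _ fun a _ =>
        AddSubgroup.zsmul_mem _ (AddSubgroup.subset_closure (hBS a)) _
    rcases Int.natAbs_eq A.det with h | h
    · rwa [← h]
    · have hneg : ((A.det.natAbs : ℤ)) = -A.det := by omega
      rw [hneg, neg_smul]
      exact AddSubgroup.neg_mem _ hmem
  · intro i j
    rw [hTI i (f j).2]
    simp [Subtype.val_inj, eq_comm]

/-! ### Uniformly random elements of multisets -/

/-- The average of `f` over the multiset `Q`; it is `0` if `Q` is empty. -/
noncomputable def Multiset.average {α : Type*} (Q : Multiset α) (f : α → ℝ) : ℝ :=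
  (Q.map f).sum / Q.card

namespace Multiset

variable {α : Type*} {Q : Multiset α} {f f' : α → ℝ} {c : ℝ}

@[simp]
theorem average_singleton (a : α) (f : α → ℝ) : average {a} f = f a := by
  simp [average]

theorem average_congr (h : ∀ q ∈ Q, f q = f' q) : Q.average f = Q.average f' := by
  rw [average, average, Multiset.map_congr rfl h]

theorem average_le (hQ : Q ≠ 0) (h : ∀ q ∈ Q, f q ≤ c) : Q.average f ≤ c := by
  have hcard : (0 : ℝ) < Q.card := by exact_mod_cast Multiset.card_pos.2 hQ
  rw [average, div_le_iff₀ hcard, mul_comm, ← nsmul_eq_mul]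
  simpa using Multiset.sum_le_card_nsmul (Q.map f) c (by simpa using h)

theorem average_sub (Q : Multiset α) (f f' : α → ℝ) :
    Q.average (fun q => f q - f' q) = Q.average f - Q.average f' := by
  simp [average, Multiset.sum_map_sub, sub_div]

theorem average_const (hQ : Q ≠ 0) (c : ℝ) : (Q.average fun _ => c) = c := by
  have hcard : (Q.card : ℝ) ≠ 0 := by exact_mod_cast (Multiset.card_pos.2 hQ).ne'
  simp [average, hcard]

theorem le_average (hQ : Q ≠ 0) (h : ∀ q ∈ Q, c ≤ f q) : c ≤ Q.average f := by
  have h' := average_le (f := fun q => c - f q) hQ (c := 0) fun q hq => by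
    linarith [h q hq]
  rw [average_sub, average_const hQ] at h'
  linarith

theorem abs_average_sub_le (hQ : Q ≠ 0) (h : ∀ q ∈ Q, |f q - f' q| ≤ c) :
    |Q.average f - Q.average f'| ≤ c := by
  rw [← average_sub, abs_le]
  exact ⟨le_average hQ fun q hq => (abs_le.1 (h q hq)).1,
    average_le hQ fun q hq => (abs_le.1 (h q hq)).2⟩

theorem sum_average {ι : Type*} (s : Finset ι) (Q : Multiset α) (f : ι → α → ℝ) :
    ∑ i ∈ s, Q.average (f i) = Q.average fun q => ∑ i ∈ s, f i q := by
  simp only [average, ← Finset.sum_div]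
  congr 1
  induction Q using Multiset.induction_on with
  | empty => simp
  | cons a Q ih => simp [Finset.sum_add_distrib, ih]

/-- An average is pulled towards the value `v` at a single element, with the weight of that
element. -/
theorem average_le_of_mem {v hi : ℝ} {a : α} (ha : a ∈ Q) (hv : f a = v) (h : ∀ q ∈ Q, f q ≤ hi) :
    Q.average f ≤ hi - (hi - v) / Q.card := by
  have hcard : (0 : ℝ) < Q.card := by exact_mod_cast Multiset.card_pos_iff_exists_mem.2 ⟨a, ha⟩
  have hQ : Q ≠ 0 := fun h => by simp [h] at ha
  have hsum : hi - v ≤ (Q.map fun q => hi - f q).sum := by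
    refine Multiset.single_le_sum ?_ _ (Multiset.mem_map.2 ⟨a, ha, by rw [hv]⟩)
    intro x hx
    obtain ⟨q, hq, rfl⟩ := Multiset.mem_map.1 hx
    exact sub_nonneg.2 (h q hq)
  have havg : (Q.average fun q => hi - f q) = hi - Q.average f := by
    rw [average_sub, average_const hQ]
  have hle : (hi - v) / Q.card ≤ Q.average fun q => hi - f q := by
    rw [average]
    gcongr
  linarith

theorem le_average_of_mem {v lo : ℝ} {a : α} (ha : a ∈ Q) (hv : f a = v) (h : ∀ q ∈ Q, lo ≤ f q) :
    lo + (v - lo) / Q.card ≤ Q.average f := by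
  have hneg : (Q.average fun q => -f q) = -Q.average f := by
    simp [average, neg_div]
  have h' := average_le_of_mem (f := fun q => -f q) (hi := -lo) ha rfl fun q hq => neg_le_neg (h q hq)
  rw [hneg, hv] at h'
  have : (-lo - -v) / (Q.card : ℝ) = (v - lo) / Q.card := by ring
  linarith

end Multiset

/-! ### Random streams -/

/-- The concatenation of two independent random streams; a finite multiset of streams stands for a
uniformly random element of it. -/
def concatStreams {n : ℕ} (Q Q' : Multiset (DynamicStream n)) : Multiset (DynamicStream n) :=
  Q.bind fun q => Q'.map fun q' => q ++ q'

section RandomStreams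

variable {n : ℕ} {Q Q' : Multiset (DynamicStream n)}

theorem mem_concatStreams {σ : DynamicStream n} :
    σ ∈ concatStreams Q Q' ↔ ∃ q ∈ Q, ∃ q' ∈ Q', q ++ q' = σ := by
  simp [concatStreams]

theorem average_concatStreams (Q Q' : Multiset (DynamicStream n)) (f : DynamicStream n → ℝ) :
    (concatStreams Q Q').average f = Q.average fun q => Q'.average fun q' => f (q ++ q') := by
  simp only [Multiset.average, concatStreams, Multiset.map_bind, Multiset.sum_bind,
    Multiset.map_map, Multiset.card_bind, Multiset.card_map, Function.comp_def]
  simp only [div_eq_mul_inv, Multiset.sum_map_mul_right, Multiset.map_const', Multiset.sum_replicate,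
    smul_eq_mul, Nat.cast_mul, mul_inv, mul_assoc]
  rw [mul_comm (Q.card : ℝ)⁻¹]

/-- A random stream whose elements all have frequency vector `0`. -/
structure IsZeroFreq (Q : Multiset (DynamicStream n)) : Prop where
  ne_zero : Q ≠ 0
  freq_eq : ∀ q ∈ Q, freq q = 0

theorem IsZeroFreq.singleton_nil : IsZeroFreq ({[]} : Multiset (DynamicStream n)) :=
  ⟨by simp, by simp⟩

theorem IsZeroFreq.concat (hQ : IsZeroFreq Q) (hQ' : IsZeroFreq Q') :
    IsZeroFreq (concatStreams Q Q') := by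
  refine ⟨?_, ?_⟩
  · obtain ⟨q, hq⟩ := Multiset.exists_mem_of_ne_zero hQ.ne_zero
    obtain ⟨q', hq'⟩ := Multiset.exists_mem_of_ne_zero hQ'.ne_zero
    intro h
    have : q ++ q' ∈ concatStreams Q Q' := mem_concatStreams.2 ⟨q, hq, q', hq', rfl⟩
    simp [h] at this
  · intro σ hσ
    obtain ⟨q, hq, q', hq', rfl⟩ := mem_concatStreams.1 hσ
    simp [hQ.freq_eq q hq, hQ'.freq_eq q' hq']

/-- The concatenation of `k` independent copies of `Q`. -/
def powStreams (Q : Multiset (DynamicStream n)) : ℕ → Multiset (DynamicStream n)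
  | 0 => {[]}
  | k + 1 => concatStreams Q (powStreams Q k)

theorem IsZeroFreq.pow (hQ : IsZeroFreq Q) : ∀ k, IsZeroFreq (powStreams Q k)
  | 0 => .singleton_nil
  | k + 1 => hQ.concat (hQ.pow k)

/-- The random loop that subtracts `z`, performs `Q`, and adds `z`. -/
noncomputable def conjStreams (Q : Multiset (DynamicStream n)) (z : Fin n → ℤ) :
    Multiset (DynamicStream n) :=
  Q.map fun q => ofFreq (-z) ++ q ++ ofFreq z

theorem IsZeroFreq.conj (hQ : IsZeroFreq Q) (z : Fin n → ℤ) : IsZeroFreq (conjStreams Q z) := by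
  refine ⟨by simpa [conjStreams] using hQ.ne_zero, fun σ hσ => ?_⟩
  obtain ⟨q, hq, rfl⟩ := Multiset.mem_map.1 hσ
  simp [hQ.freq_eq q hq]

theorem average_conjStreams (Q : Multiset (DynamicStream n)) (z : Fin n → ℤ)
    (f : DynamicStream n → ℝ) :
    (conjStreams Q z).average f = Q.average fun q => f (ofFreq (-z) ++ q ++ ofFreq z) := by
  simp [conjStreams, Multiset.average]

/-- The concatenation of the loops of `Q` at all vectors of a list. -/
noncomputable def loopStreams (Q : Multiset (DynamicStream n)) :
    List (Fin n → ℤ) → Multiset (DynamicStream n)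
  | [] => {[]}
  | z :: l => concatStreams (conjStreams Q z) (loopStreams Q l)

theorem IsZeroFreq.loop (hQ : IsZeroFreq Q) : ∀ l, IsZeroFreq (loopStreams Q l)
  | [] => .singleton_nil
  | z :: l => (hQ.conj z).concat (hQ.loop l)

end RandomStreams

/-! ### Mixing -/

section Mixing

variable {n : ℕ} {W : Type*} {st : DynamicStream n → W} {γ : DynamicStream n}

/-- A `[0, 1]`-valued function of the state. -/
structure IsTest (st : DynamicStream n → W) (h : DynamicStream n → ℝ) : Prop where
  nonneg : ∀ σ, 0 ≤ h σ
  le_one : ∀ σ, h σ ≤ 1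
  congr : ∀ σ σ', st σ = st σ' → h σ = h σ'

theorem IsTest.average {h : DynamicStream n → ℝ} (hh : IsTest st h) (hst : IsRightCongruence st)
    {Q : Multiset (DynamicStream n)} (hQ : Q ≠ 0) :
    IsTest st fun σ => Q.average fun q => h (σ ++ q) where
  nonneg _ := Multiset.le_average hQ fun _ _ => hh.nonneg _
  le_one _ := Multiset.average_le hQ fun _ _ => hh.le_one _
  congr _ _ hσ := Multiset.average_congr fun q _ => hh.congr _ _ (hst hσ q)

/-- Doeblin's argument: if from every state that zero-frequency streams reach after `γ` some element
of `Q` leads back to `γ`, then each copy of `Q` contracts the range of the average of a test by the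
factor `1 - 1 / |Q|`. -/
theorem exists_average_powStreams_mem_Icc {Q : Multiset (DynamicStream n)} (hQ : IsZeroFreq Q)
    (hst : IsRightCongruence st)
    (hret : ∀ τ, freq τ = 0 → ∃ q ∈ Q, st (γ ++ τ ++ q) = st γ)
    {h : DynamicStream n → ℝ} (hh : IsTest st h) (k : ℕ) :
    ∃ lo hi : ℝ, hi - lo ≤ (1 - 1 / (Q.card : ℝ)) ^ k ∧ ∀ τ, freq τ = 0 →
      ((powStreams Q k).average fun q => h (γ ++ τ ++ q)) ∈ Set.Icc lo hi := by
  induction k with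
  | zero => exact ⟨0, 1, by simp, fun τ _ => by simpa [powStreams] using ⟨hh.nonneg _, hh.le_one _⟩⟩
  | succ k ih =>
    obtain ⟨lo, hi, hlohi, hmem⟩ := ih
    have hcard : (1 : ℝ) ≤ Q.card := by exact_mod_cast Multiset.card_pos.2 hQ.ne_zero
    have hfactor : 0 ≤ 1 - 1 / (Q.card : ℝ) := by
      rw [sub_nonneg, div_le_one (by linarith)]
      exact hcard
    let F (σ : DynamicStream n) : ℝ := (powStreams Q k).average fun q => h (σ ++ q)
    have hF : IsTest st F := hh.average hst (hQ.pow k).ne_zero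
    refine ⟨lo + (F γ - lo) / Q.card, hi - (hi - F γ) / Q.card, ?_, fun τ hτ => ?_⟩
    · calc hi - (hi - F γ) / Q.card - (lo + (F γ - lo) / Q.card)
          = (hi - lo) * (1 - 1 / (Q.card : ℝ)) := by ring
        _ ≤ (1 - 1 / (Q.card : ℝ)) ^ k * (1 - 1 / (Q.card : ℝ)) := by gcongr
        _ = (1 - 1 / (Q.card : ℝ)) ^ (k + 1) := (pow_succ _ _).symm
    · have heq : ((powStreams Q (k + 1)).average fun q => h (γ ++ τ ++ q)) =
          Q.average fun q => F (γ ++ τ ++ q) := by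
        simp [powStreams, average_concatStreams, F]
      obtain ⟨q₀, hq₀, hq₀st⟩ := hret τ hτ
      have hbound : ∀ q ∈ Q, F (γ ++ τ ++ q) ∈ Set.Icc lo hi := fun q hq => by
        simpa [F] using hmem (τ ++ q) (by simp [hτ, hQ.freq_eq q hq])
      rw [heq]
      exact ⟨Multiset.le_average_of_mem hq₀ (hF.congr _ _ hq₀st) fun q hq => (hbound q hq).1,
        Multiset.average_le_of_mem hq₀ (hF.congr _ _ hq₀st) fun q hq => (hbound q hq).2⟩

/-- A single random zero-frequency stream mixes the recurrent classes of finitely many right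
congruences simultaneously. -/
theorem exists_mixing_stream {ι : Type*} [Fintype ι] {st : ι → DynamicStream n → W}
    (hfin : ∀ i, {w | ∃ σ, freq σ = 0 ∧ st i σ = w}.Finite)
    (hst : ∀ i, IsRightCongruence (st i)) (hγ₀ : freq γ = 0) (hγ : ∀ i, IsRecurrent (st i) γ)
    {ε : ℝ} (hε : 0 < ε) :
    ∃ Q : Multiset (DynamicStream n), IsZeroFreq Q ∧ ∀ i h, IsTest (st i) h →
      ∀ τ τ', freq τ = 0 → freq τ' = 0 →
        |(Q.average fun q => h (γ ++ τ ++ q)) - Q.average fun q => h (γ ++ τ' ++ q)| ≤ ε := by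
  classical
  -- `R` chooses a stream that leads from a given state back to `γ`.
  have hR (i : ι) (w : W) : ∃ ρ, freq ρ = 0 ∧
      ∀ τ, freq τ = 0 → st i (γ ++ τ) = w → st i (γ ++ τ ++ ρ) = st i γ := by
    by_cases hw : ∃ τ, freq τ = 0 ∧ st i (γ ++ τ) = w
    · obtain ⟨τ, hτ, rfl⟩ := hw
      obtain ⟨ρ, hρ, hρst⟩ := hγ i τ hτ
      exact ⟨ρ, hρ, fun τ' _ h => by rw [hst i h, hρst]⟩
    · exact ⟨[], rfl, fun τ hτ h => absurd ⟨τ, hτ, h⟩ hw⟩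
  choose R hR₀ hRst using hR
  let P : Multiset (DynamicStream n) :=
    {[]} + Finset.univ.val.bind fun i => (hfin i).toFinset.val.map (R i)
  have hP : IsZeroFreq P := by
    refine ⟨by simp [P], fun q hq => ?_⟩
    rcases Multiset.mem_add.1 hq with hq | hq
    · rw [Multiset.mem_singleton.1 hq, freq_nil]
    · obtain ⟨i, -, hq⟩ := Multiset.mem_bind.1 hq
      obtain ⟨w, -, rfl⟩ := Multiset.mem_map.1 hq
      exact hR₀ i w
  have hret (i : ι) (τ : DynamicStream n) (hτ : freq τ = 0) :
      ∃ q ∈ P, st i (γ ++ τ ++ q) = st i γ := by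
    refine ⟨R i (st i (γ ++ τ)), ?_, hRst i _ τ hτ rfl⟩
    refine Multiset.mem_add.2 (.inr (Multiset.mem_bind.2 ⟨i, Finset.mem_univ_val i, ?_⟩))
    refine Multiset.mem_map.2 ⟨_, ?_, rfl⟩
    rw [Finset.mem_val, Set.Finite.mem_toFinset]
    exact ⟨γ ++ τ, by simp [hγ₀, hτ], rfl⟩
  have hcard : (1 : ℝ) ≤ P.card := by exact_mod_cast Multiset.card_pos.2 hP.ne_zero
  have hpos : 0 < 1 / (P.card : ℝ) := by positivity
  obtain ⟨k, hk⟩ := exists_pow_lt_of_lt_one hε (by linarith : 1 - 1 / (P.card : ℝ) < 1)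
  refine ⟨powStreams P k, hP.pow k, fun i h hh τ τ' hτ hτ' => ?_⟩
  obtain ⟨lo, hi, hlohi, hmem⟩ := exists_average_powStreams_mem_Icc hP (hst i) (hret i) hh k
  exact (abs_sub_le_of_le_of_le (hmem τ hτ).1 (hmem τ hτ).2 (hmem τ' hτ').1 (hmem τ' hτ').2).trans
    (hlohi.trans hk.le)

/-- After a loop of a mixing stream `Q` at `freq β`, a test cannot distinguish the histories `β` and
`β'` if their frequency vectors agree modulo the loop group: both return to the finite recurrent
class of `γ` within the loop, are mixed there, and continue in the same way.  The loops at other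
vectors do no harm. -/
theorem abs_average_loopStreams_sub_le (hst : IsRightCongruence st) (hγ : IsRecurrent st γ)
    {Q : Multiset (DynamicStream n)} (hQ : IsZeroFreq Q) {ε : ℝ}
    (hmix : ∀ h, IsTest st h → ∀ τ τ', freq τ = 0 → freq τ' = 0 →
      |(Q.average fun q => h (γ ++ τ ++ q)) - Q.average fun q => h (γ ++ τ' ++ q)| ≤ ε)
    {h : DynamicStream n → ℝ} (hh : IsTest st h) {l : List (Fin n → ℤ)}
    {β β' : DynamicStream n} (hl : freq β ∈ l) (hββ' : freq β - freq β' ∈ loopGroup hst hγ) :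
    |((loopStreams Q l).average fun q => h (γ ++ β ++ q)) -
      (loopStreams Q l).average fun q => h (γ ++ β' ++ q)| ≤ ε := by
  induction l generalizing β β' with
  | nil => simp at hl
  | cons z l ih =>
    let F (σ : DynamicStream n) : ℝ := (loopStreams Q l).average fun q => h (σ ++ q)
    have hF : IsTest st F := hh.average hst (hQ.loop l).ne_zero
    have heq (σ : DynamicStream n) : ((loopStreams Q (z :: l)).average fun q => h (σ ++ q)) =
        Q.average fun q => F (σ ++ (ofFreq (-z) ++ q ++ ofFreq z)) := by
      simp [loopStreams, average_concatStreams, average_conjStreams, F]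
    rw [heq, heq]
    by_cases hz : freq β = z
    · -- A history whose frequency vector lies in the loop group can be replaced by a
      -- zero-frequency one.
      have hzero (α : DynamicStream n) (hα : freq α ∈ loopGroup hst hγ) :
          ∃ τ, freq τ = 0 ∧ st (γ ++ τ) = st (γ ++ α) := by
        have := exists_zero_freq_of_sub_mem hst hγ (β := []) (β' := α)
          (by simpa using neg_mem hα)
        simpa using this
      let G (σ : DynamicStream n) : ℝ := F (σ ++ ofFreq z)
      have hG : IsTest st G :=
        ⟨fun _ => hF.nonneg _, fun _ => hF.le_one _, fun _ _ hσ => hF.congr _ _ (hst hσ _)⟩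
      obtain ⟨τ, hτ, hτst⟩ := hzero (β ++ ofFreq (-z)) (by simp [hz, zero_mem])
      obtain ⟨τ', hτ', hτst'⟩ := hzero (β' ++ ofFreq (-z)) (by
        simpa [hz, sub_eq_add_neg] using neg_mem hββ')
      have hG₁ (q : DynamicStream n) :
          F (γ ++ β ++ (ofFreq (-z) ++ q ++ ofFreq z)) = G (γ ++ τ ++ q) := by
        rw [hG.congr _ _ (hst hτst q)]
        simp [G]
      have hG₂ (q : DynamicStream n) :
          F (γ ++ β' ++ (ofFreq (-z) ++ q ++ ofFreq z)) = G (γ ++ τ' ++ q) := by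
        rw [hG.congr _ _ (hst hτst' q)]
        simp [G]
      simp only [hG₁, hG₂]
      exact hmix G hG τ τ' hτ hτ'
    · have hl' : freq β ∈ l := (List.mem_cons.1 hl).resolve_left hz
      refine Multiset.abs_average_sub_le hQ.ne_zero fun q hq => ?_
      have hq₀ : freq (ofFreq (-z) ++ q ++ ofFreq z) = 0 := by simp [hQ.freq_eq q hq]
      have := ih (β := β ++ (ofFreq (-z) ++ q ++ ofFreq z))
        (β' := β' ++ (ofFreq (-z) ++ q ++ ofFreq z))
        (by rwa [freq_append, hq₀, add_zero])
        (by rwa [freq_append β, freq_append β', hq₀, add_zero, add_zero])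
      simpa [F] using this

end Mixing

/-! ### The sketch of a single random tape -/

/-- For a fixed random tape, the small vectors of the loop group determine a matrix with few rows:
the `0/1`-vectors on the coordinates on which the matrix is injective end in different final
tapes. -/
theorem StreamingAlgorithm.exists_sketch_matrix {n : ℕ} (A : StreamingAlgorithm n)
    (hfin : (A.finalTapes 1).Finite) {ω : ℕ → Bool} {γ : DynamicStream n} (hγ₀ : freq γ = 0)
    (hγ : IsRecurrent (A.finalTape ω) γ) :
    ∃ (s : ℕ) (T : Matrix (Fin s) (Fin n) ℤ), ((s : ℝ) : EReal) ≤ A.space 1 ∧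
      (∀ i j, |(T i j : ℝ)| ≤ (n : ℝ) ^ ((n : ℝ) / 2)) ∧
      ∀ x y, T.mulVec x = T.mulVec y →
        (n.factorial.factorial : ℤ) • (x - y) ∈ loopGroup (A.isRightCongruence_finalTape ω) hγ := by
  classical
  set K := loopGroup (A.isRightCongruence_finalTape ω) hγ
  let S : Set (Fin n → ℤ) := {v | v ∈ K ∧ ∀ i, |v i| ≤ 1}
  obtain ⟨s, T, e, c, d, hd, hdn, hc, he, hT, hTS, hTker, hTe⟩ :=
    exists_small_matrix_ker_eq_span (S := S) fun v hv => hv.2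
  refine ⟨s, T, ?_, hT, fun x y hxy => ?_⟩
  · let ind (b : Fin s → Bool) : Fin n → ℤ := ∑ j, Pi.single (e j) (if b j then 1 else 0)
    have hind_e (b : Fin s → Bool) (j : Fin s) : ind b (e j) = if b j then 1 else 0 := by
      simp [ind, Finset.sum_apply, Pi.single_apply, he.eq_iff]
    have hind_not (b : Fin s → Bool) (i : Fin n) (hi : i ∉ Set.range e) : ind b i = 0 := by
      have h (j : Fin s) : i ≠ e j := fun h => hi ⟨j, h.symm⟩
      simp [ind, Finset.sum_apply, h]
    have hind01 (b : Fin s → Bool) (i : Fin n) : 0 ≤ ind b i ∧ ind b i ≤ 1 := by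
      by_cases hi : i ∈ Set.range e
      · obtain ⟨j, rfl⟩ := hi
        rw [hind_e]
        split_ifs <;> simp
      · simp [hind_not b i hi]
    have hTind (b : Fin s → Bool) (i : Fin s) : T.mulVec (ind b) i = c * if b i then 1 else 0 := by
      have h : ind b = ∑ j, (if b j then (1 : ℤ) else 0) • Pi.single (e j) 1 := by
        refine Finset.sum_congr rfl fun j _ => ?_
        split_ifs <;> simp
      rw [h, Matrix.mulVec_sum, Finset.sum_apply]
      simp only [Matrix.mulVec_smul, Matrix.mulVec_single_one, Pi.smul_apply, Matrix.col_apply,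
        hTe, smul_eq_mul]
      simp
    let tape (b : Fin s → Bool) : List Bool := A.finalTape ω (γ ++ ofFreq (ind b))
    have htape_mem (b) : tape b ∈ A.finalTapes 1 :=
      A.finalTape_mem_finalTapes ω fun i => by simpa [hγ₀] using hind01 b i
    have htape_inj : Function.Injective tape := by
      intro b b' hbb
      have hK : ind b - ind b' ∈ K := by
        have h := sub_mem_loopGroup (A.isRightCongruence_finalTape ω) hγ hbb
        rwa [freq_ofFreq, freq_ofFreq] at h
      have hS : ind b - ind b' ∈ S := by
        refine ⟨hK, fun i => ?_⟩
        have h₁ := hind01 b i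
        have h₂ := hind01 b' i
        rw [Pi.sub_apply, abs_le]
        omega
      have hT₀ := hTS _ hS
      rw [Matrix.mulVec_sub, sub_eq_zero] at hT₀
      ext i
      have h := congrFun hT₀ i
      rw [hTind, hTind] at h
      have h' := mul_left_cancel₀ hc h
      cases hb : b i <;> cases hb' : b' i <;> simp [hb, hb'] at h' ⊢
    have hcard : 2 ^ s ≤ (A.finalTapes 1).ncard := by
      have h := Set.ncard_le_ncard (Set.range_subset_iff.2 htape_mem) hfin
      rwa [Set.ncard_range_of_injective htape_inj, Nat.card_eq_fintype_card, Fintype.card_fun,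
        Fintype.card_bool, Fintype.card_fin] at h
    rw [StreamingAlgorithm.space, if_pos hfin, EReal.coe_le_coe_iff,
      Real.le_logb_iff_rpow_le one_lt_two (by
        exact_mod_cast (Nat.two_pow_pos s).trans_le hcard), Real.rpow_natCast]
    exact_mod_cast hcard
  · have h₀ : T.mulVec (x - y) = 0 := by rw [Matrix.mulVec_sub, hxy, sub_self]
    have hSK : AddSubgroup.closure S ≤ K := (AddSubgroup.closure_le K).2 fun v hv => hv.1
    obtain ⟨m, hm⟩ := Nat.dvd_factorial hd hdn
    rw [hm, Nat.cast_mul, mul_comm, mul_smul]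
    exact K.zsmul_mem (hSK (hTker _ h₀)) _

/-! ### Decoding -/

/-- If the acceptance probabilities `p` of points of `F` with the same image under `T` differ by at
most `1/4`, a decoder that rounds the probability at one point of each fibre is right wherever the
error probability is below `1/4`. -/
theorem exists_decoder {X Y : Type*} (F : Set X) (T : X → Y) (p : X → ℝ)
    (h : ∀ x ∈ F, ∀ y ∈ F, T x = T y → |p x - p y| ≤ 1 / 4) :
    ∃ Dec : Y → Bool, ∀ x ∈ F,
      (Dec (T x) = false → p x ≤ 3 / 4) ∧ (Dec (T x) = true → 1 / 4 ≤ p x) := by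
  classical
  refine ⟨fun t => if ht : ∃ y ∈ F, T y = t then decide (1 / 2 ≤ p ht.choose) else false,
    fun x hx => ?_⟩
  have ht : ∃ y ∈ F, T y = T x := ⟨x, hx, rfl⟩
  have habs := abs_le.1 (h x hx _ ht.choose_spec.1 ht.choose_spec.2.symm)
  simp only [dif_pos ht, decide_eq_false_iff_not, decide_eq_true_eq, not_le]
  constructor <;> intro <;> linarith

/-! ### Error probabilities as finite sums -/

namespace StreamingAlgorithm

variable {n : ℕ} {A : StreamingAlgorithm n} {g : (Fin n → ℤ) → Option Bool} {δ : ℝ}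

open Classical in
/-- The indicator of an error of `A` on the stream `σ` with random tape `ω`. -/
noncomputable def errorAt (A : StreamingAlgorithm n) (g : (Fin n → ℤ) → Option Bool)
    (ω : ℕ → Bool) (σ : DynamicStream n) : ℝ :=
  if g (freq σ) ≠ none ∧ some (A.output ω σ) ≠ g (freq σ) then 1 else 0

theorem Computes.sum_errorAt_le (h : A.Computes g δ) {m : ℕ} {σ : DynamicStream n}
    (hσ : ∀ i, |freq σ i| ≤ (m : ℤ)) :
    ∑ ρ : Fin (A.r m) → Bool, A.errorAt g (padTape ρ) σ ≤
      δ * Fintype.card (Fin (A.r m) → Bool) := by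
  classical
  have h' := h m σ hσ
  rw [MeasureTheory.measureReal_def,
    PMF.toMeasure_uniformOfFintype_apply _ (Set.toFinite _).measurableSet,
    ENNReal.toReal_div, div_le_iff₀ (by simp)] at h'
  simpa [errorAt, Fintype.card_subtype] using h'

theorem Computes.nonneg (h : A.Computes g δ) : 0 ≤ δ :=
  MeasureTheory.measureReal_nonneg.trans (h 0 [] (by simp))

theorem errorAt_nonneg (ω : ℕ → Bool) (σ : DynamicStream n) : 0 ≤ A.errorAt g ω σ := by
  unfold errorAt
  split_ifs <;> simp

/-- An algorithm with error probability `0` is right on every stream with the random tape `0`. -/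
theorem Computes.output_eq (h : A.Computes g 0) {σ : DynamicStream n} (hσ : g (freq σ) ≠ none) :
    some (A.output (fun _ => false) σ) = g (freq σ) := by
  by_contra hne
  obtain ⟨m, hm⟩ : ∃ m : ℕ, ∀ i, |freq σ i| ≤ (m : ℤ) := by
    refine ⟨∑ i, (freq σ i).natAbs, fun i => ?_⟩
    rw [Int.abs_eq_natAbs]
    exact_mod_cast Finset.single_le_sum (f := fun i => (freq σ i).natAbs) (fun _ _ => Nat.zero_le _)
      (Finset.mem_univ i)
  have hpad : padTape (fun _ : Fin (A.r m) => false) = fun _ => false := by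
    ext k
    simp [padTape]
  have hle := h.sum_errorAt_le hm
  have hone := Finset.single_le_sum (f := fun ρ : Fin (A.r m) → Bool => A.errorAt g (padTape ρ) σ)
    (fun _ _ => errorAt_nonneg _ _) (Finset.mem_univ fun _ => false)
  simp only [hpad] at hone
  have hval : A.errorAt g (fun _ => false) σ = 1 := if_pos ⟨hσ, hne⟩
  linarith

end StreamingAlgorithm

theorem PMF.exists_finset_one_sub_le_sum {α : Type*} (D : PMF α) {δ : ℝ} (hδ : 0 < δ) :
    ∃ F : Finset α, (∀ x ∈ F, x ∈ D.support) ∧ 1 - δ ≤ ∑ x ∈ F, (D x).toReal := by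
  classical
  have hsum : HasSum (fun x => (D x).toReal) 1 := by
    have h := (ENNReal.summable_toReal D.tsum_coe_ne_top).hasSum
    rwa [← ENNReal.tsum_toReal_eq D.apply_ne_top, D.tsum_coe, ENNReal.toReal_one] at h
  obtain ⟨F, hF⟩ := (hsum.eventually (lt_mem_nhds (sub_lt_self 1 hδ))).exists
  refine ⟨F.filter (· ∈ D.support), fun x hx => (Finset.mem_filter.1 hx).2, hF.le.trans_eq ?_⟩
  refine (Finset.sum_filter_of_ne fun x _ hx => ?_).symm
  rw [PMF.mem_support_iff]
  rintro h
  simp [h] at hx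

/-! ### Small linear sketches -/

namespace StreamingAlgorithm

variable {n : ℕ} {A : StreamingAlgorithm n} {g : (Fin n → ℤ) → Option Bool} {δ : ℝ}

/-- An algorithm without errors can be run with a fixed random tape, and vectors with the same
sketch have multiples that end in the same final tape; this needs no mixing, and it makes `g` a
function of the sketch. -/
theorem exists_sketch_of_computes_zero (hfin : (A.finalTapes 1).Finite) (hg : ScaleInvariant g)
    (hA : A.Computes g 0) :
    ∃ (s : ℕ) (T : Matrix (Fin s) (Fin n) ℤ), ((s : ℝ) : EReal) ≤ A.space 1 ∧
      (∀ i j, |(T i j : ℝ)| ≤ (n : ℝ) ^ ((n : ℝ) / 2)) ∧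
      ∃ Dec : (Fin s → ℤ) → Bool, ∀ x, g x ≠ none → some (Dec (T.mulVec x)) = g x := by
  classical
  let ω : ℕ → Bool := fun _ => false
  obtain ⟨γ, hγ₀, hγ⟩ := exists_isRecurrent (ι := Unit) (st := fun _ => A.finalTape ω)
    fun _ => A.finite_range_finalTape hfin ω
  obtain ⟨s, T, hs, hT, hker⟩ := A.exists_sketch_matrix hfin hγ₀ (hγ ())
  set a : ℤ := (n.factorial.factorial : ℤ)
  have ha : 0 < a := Int.natCast_pos.2 (Nat.factorial_pos _)
  have hfibre {x y : Fin n → ℤ} (hx : g x ≠ none) (hy : g y ≠ none)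
      (hxy : T.mulVec x = T.mulVec y) : g x = g y := by
    obtain ⟨τ, hτ, hst⟩ := exists_zero_freq_of_sub_mem (A.isRightCongruence_finalTape ω) (hγ ())
      (β := ofFreq (a • x)) (β' := ofFreq (a • y))
      (by simpa only [freq_ofFreq, ← smul_sub] using hker x y hxy)
    have hfx : freq (γ ++ ofFreq (a • x) ++ τ) = a • x := by simp [hγ₀, hτ]
    have hfy : freq (γ ++ ofFreq (a • y)) = a • y := by simp [hγ₀]
    have hox := hA.output_eq (σ := γ ++ ofFreq (a • x) ++ τ) (by rwa [hfx, hg a ha])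
    have hoy := hA.output_eq (σ := γ ++ ofFreq (a • y)) (by rwa [hfy, hg a ha])
    rw [hfx, hg a ha] at hox
    rw [hfy, hg a ha] at hoy
    rw [← hox, ← hoy, output, output]
    exact congrArg (fun w => some (A.dec w ω)) hst
  refine ⟨s, T, hs, hT, fun t =>
    if ht : ∃ y, g y ≠ none ∧ T.mulVec y = t then (g ht.choose).getD false else false,
    fun x hx => ?_⟩
  have ht : ∃ y, g y ≠ none ∧ T.mulVec y = T.mulVec x := ⟨x, hx, rfl⟩
  dsimp only
  rw [dif_pos ht, hfibre ht.choose_spec.1 hx ht.choose_spec.2]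
  obtain ⟨b, hb⟩ := Option.ne_none_iff_exists'.1 hx
  simp [hb]

open Classical in
/-- On a finite set of inputs, all of them multiplied by the common factor that turns rational into
integral combinations, the loops of a mixing stream make the acceptance probability almost a
function of the sketch, for all random tapes at the same time; one of the tapes does not err more
often than the average. -/
theorem exists_sketch_of_computes (hfin : (A.finalTapes 1).Finite) (hg : ScaleInvariant g)
    (hA : A.Computes g δ) (D : (Fin n → ℤ) → ℝ) (hD : ∀ x, 0 ≤ D x) (F : Finset (Fin n → ℤ))
    (hDF : ∑ x ∈ F, D x ≤ 1) (hF : ∀ x ∈ F, g x ≠ none) :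
    ∃ (s : ℕ) (T : Matrix (Fin s) (Fin n) ℤ), ((s : ℝ) : EReal) ≤ A.space 1 ∧
      (∀ i j, |(T i j : ℝ)| ≤ (n : ℝ) ^ ((n : ℝ) / 2)) ∧
      ∃ Dec : (Fin s → ℤ) → Bool,
        ∑ x ∈ F with some (Dec (T.mulVec x)) ≠ g x, D x ≤ 4 * δ := by
  set a : ℤ := (n.factorial.factorial : ℤ)
  have ha : 0 < a := Int.natCast_pos.2 (Nat.factorial_pos _)
  obtain ⟨m, hm⟩ : ∃ m : ℕ, ∀ x ∈ F, ∀ i, |(a • x) i| ≤ (m : ℤ) := by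
    refine ⟨∑ x ∈ F, ∑ i, ((a • x) i).natAbs, fun x hx i => ?_⟩
    rw [Int.abs_eq_natAbs]
    exact_mod_cast (Finset.single_le_sum (f := fun i => ((a • x) i).natAbs)
      (fun _ _ => Nat.zero_le _) (Finset.mem_univ i)).trans
      (Finset.single_le_sum (f := fun x : Fin n → ℤ => ∑ i, ((a • x) i).natAbs)
        (fun _ _ => Nat.zero_le _) hx)
  -- For the frequency vectors `a • x` with `x ∈ F`, the error bound is an average over these finitely
  -- many tapes.
  let Ω := Fin (A.r m) → Bool
  let st (ρ : Ω) : DynamicStream n → List Bool := A.finalTape (padTape ρ)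
  have hst (ρ : Ω) : IsRightCongruence (st ρ) := A.isRightCongruence_finalTape _
  have hfin' (ρ : Ω) : {w | ∃ σ, freq σ = 0 ∧ st ρ σ = w}.Finite := A.finite_range_finalTape hfin _
  obtain ⟨γ, hγ₀, hγ⟩ := exists_isRecurrent hfin'
  -- Accuracy `1/4` lets rounding tell acceptance probabilities `0` and `1` apart, with a margin
  -- that costs the factor `4` in the error.
  obtain ⟨Q, hQ, hmix⟩ := exists_mixing_stream hfin' hst hγ₀ hγ (ε := 1 / 4) (by norm_num)
  choose s T hs hT hker using fun ρ => A.exists_sketch_matrix hfin hγ₀ (hγ ρ)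
  let L := loopStreams Q (F.toList.map (a • ·))
  have hL : IsZeroFreq L := hQ.loop _
  let accept (ρ : Ω) (σ : DynamicStream n) : ℝ := if A.output (padTape ρ) σ = true then 1 else 0
  have haccept (ρ : Ω) : IsTest (st ρ) (accept ρ) := by
    refine ⟨fun σ => ?_, fun σ => ?_, fun σ σ' h => ?_⟩
    · dsimp only [accept]
      split_ifs <;> simp
    · dsimp only [accept]
      split_ifs <;> simp
    · have h' : A.output (padTape ρ) σ = A.output (padTape ρ) σ' :=
        congrArg (fun w => A.dec w (padTape ρ)) h
      simp only [accept, h']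
  let p (ρ : Ω) (x : Fin n → ℤ) : ℝ := L.average fun q => accept ρ (γ ++ ofFreq (a • x) ++ q)
  let err (ρ : Ω) (x : Fin n → ℤ) : ℝ :=
    L.average fun q => A.errorAt g (padTape ρ) (γ ++ ofFreq (a • x) ++ q)
  have hclose (ρ : Ω) : ∀ x ∈ (F : Set (Fin n → ℤ)), ∀ y ∈ (F : Set (Fin n → ℤ)),
      (T ρ).mulVec x = (T ρ).mulVec y → |p ρ x - p ρ y| ≤ 1 / 4 := by
    intro x hx y _ hxy
    refine abs_average_loopStreams_sub_le (hst ρ) (hγ ρ) hQ (hmix ρ) (haccept ρ) ?_ ?_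
    · rw [freq_ofFreq]
      exact List.mem_map.2 ⟨x, Finset.mem_toList.2 hx, rfl⟩
    · rw [freq_ofFreq, freq_ofFreq, ← smul_sub]
      exact hker ρ x y hxy
  choose Dec hDec using fun ρ => exists_decoder (F : Set (Fin n → ℤ)) (T ρ).mulVec (p ρ) (hclose ρ)
  have hfreq {x : Fin n → ℤ} {q : DynamicStream n} (hq : q ∈ L) :
      freq (γ ++ ofFreq (a • x) ++ q) = a • x := by
    simp [hγ₀, hL.freq_eq q hq]
  have herr_nonneg (ρ : Ω) (x : Fin n → ℤ) : 0 ≤ err ρ x :=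
    Multiset.le_average hL.ne_zero fun q _ => errorAt_nonneg _ _
  have hwrong (ρ : Ω) {x : Fin n → ℤ} (hx : x ∈ F) (h : some (Dec ρ ((T ρ).mulVec x)) ≠ g x) :
      1 ≤ 4 * err ρ x := by
    obtain ⟨b, hb⟩ := Option.ne_none_iff_exists'.1 (hF x hx)
    have herr_eq : err ρ x = L.average fun q =>
        if A.output (padTape ρ) (γ ++ ofFreq (a • x) ++ q) = b then (0 : ℝ) else 1 := by
      refine Multiset.average_congr fun q hq => ?_
      rw [errorAt, hfreq hq, hg a ha, hb]
      simp [ite_not]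
    cases b with
    | false =>
      have hDec' : Dec ρ ((T ρ).mulVec x) = true := by simpa [hb] using h
      have hp := (hDec ρ x hx).2 hDec'
      have : err ρ x = p ρ x := by
        rw [herr_eq]
        refine Multiset.average_congr fun q _ => ?_
        dsimp only [accept]
        cases A.output (padTape ρ) (γ ++ ofFreq (a • x) ++ q) <;> simp
      linarith
    | true =>
      have hDec' : Dec ρ ((T ρ).mulVec x) = false := by simpa [hb] using h
      have hp := (hDec ρ x hx).1 hDec'
      have : err ρ x = 1 - p ρ x := by
        have hsub := L.average_sub (fun _ => 1) fun q => accept ρ (γ ++ ofFreq (a • x) ++ q)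
        rw [Multiset.average_const hL.ne_zero] at hsub
        rw [herr_eq, ← hsub]
        refine Multiset.average_congr fun q _ => ?_
        dsimp only [accept]
        cases A.output (padTape ρ) (γ ++ ofFreq (a • x) ++ q) <;> simp
      linarith
  have herr_sum {x : Fin n → ℤ} (hx : x ∈ F) : ∑ ρ, err ρ x ≤ δ * Fintype.card Ω := by
    dsimp only [err]
    rw [Multiset.sum_average]
    refine Multiset.average_le hL.ne_zero fun q hq => hA.sum_errorAt_le ?_
    rw [hfreq hq]
    exact hm x hx
  -- The tapes can be averaged because the random stream for `x` is the same for all of them.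
  have htotal : ∑ ρ : Ω, ∑ x ∈ F with some (Dec ρ ((T ρ).mulVec x)) ≠ g x, D x ≤
      ∑ _ρ : Ω, 4 * δ := by
    calc ∑ ρ : Ω, ∑ x ∈ F with some (Dec ρ ((T ρ).mulVec x)) ≠ g x, D x
        ≤ ∑ ρ : Ω, ∑ x ∈ F, D x * (4 * err ρ x) := by
          refine Finset.sum_le_sum fun ρ _ => ?_
          rw [Finset.sum_filter]
          refine Finset.sum_le_sum fun x hx => ?_
          split_ifs with h
          · exact le_mul_of_one_le_right (hD x) (hwrong ρ hx h)
          · exact mul_nonneg (hD x) (mul_nonneg (by norm_num) (herr_nonneg ρ x))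
      _ = ∑ x ∈ F, D x * (4 * ∑ ρ, err ρ x) := by
          rw [Finset.sum_comm]
          simp only [Finset.mul_sum]
      _ ≤ ∑ x ∈ F, D x * (4 * (δ * Fintype.card Ω)) := by
          refine Finset.sum_le_sum fun x hx => ?_
          exact mul_le_mul_of_nonneg_left
            (mul_le_mul_of_nonneg_left (herr_sum hx) (by norm_num)) (hD x)
      _ = (∑ x ∈ F, D x) * (4 * (δ * Fintype.card Ω)) := by rw [Finset.sum_mul]
      _ ≤ 1 * (4 * (δ * Fintype.card Ω)) := by
          have := hA.nonneg
          gcongr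
      _ = ∑ _ρ : Ω, 4 * δ := by
          rw [Finset.sum_const, Finset.card_univ, nsmul_eq_mul]
          ring
  obtain ⟨ρ, -, hρ⟩ := Finset.exists_le_of_sum_le ⟨fun _ => false, Finset.mem_univ _⟩ htotal
  exact ⟨s ρ, T ρ, hs ρ, hT ρ, Dec ρ, hρ⟩

end StreamingAlgorithm

theorem mainTheorem2 :
    ∃ C : ℝ, 0 < C ∧
      ∀ (n : ℕ) (A : StreamingAlgorithm n) (g : (Fin n → ℤ) → Option Bool) (δ : ℝ),
        ScaleInvariant g → A.Computes g δ →
        ∀ D : PMF (Fin n → ℤ), (∀ x ∈ D.support, g x ≠ none) →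
          ∃ (s : ℕ) (T : Matrix (Fin s) (Fin n) ℤ),
            ((s : ℝ) : EReal) ≤ A.space 1 ∧
            (∀ i j, |(T i j : ℝ)| ≤ C * (n : ℝ) ^ ((n : ℝ) / 2)) ∧
            ∃ Dec : (Fin s → ℤ) → Bool,
              1 - C * δ ≤ D.toMeasure.real {x | some (Dec (T.mulVec x)) = g x} := by
  classical
  refine ⟨5, by norm_num, fun n A g δ hg hA D hD => ?_⟩
  have hδ := hA.nonneg
  have hpow : (n : ℝ) ^ ((n : ℝ) / 2) ≤ 5 * (n : ℝ) ^ ((n : ℝ) / 2) := by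
    have : 0 ≤ (n : ℝ) ^ ((n : ℝ) / 2) := Real.rpow_nonneg (Nat.cast_nonneg n) _
    linarith
  -- A decoder that is right on the whole support succeeds with probability one.
  have hexact {s : ℕ} {T : Matrix (Fin s) (Fin n) ℤ} {Dec : (Fin s → ℤ) → Bool}
      (h : ∀ x, g x ≠ none → some (Dec (T.mulVec x)) = g x) :
      1 - 5 * δ ≤ D.toMeasure.real {x | some (Dec (T.mulVec x)) = g x} := by
    have hsub : D.support ⊆ {x | some (Dec (T.mulVec x)) = g x} := fun x hx => h x (hD x hx)
    have hone : D.toMeasure {x | some (Dec (T.mulVec x)) = g x} = 1 :=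
      (D.toMeasure_apply_eq_one_iff (Set.to_countable _).measurableSet).2 hsub
    rw [MeasureTheory.measureReal_def, hone, ENNReal.toReal_one]
    linarith
  by_cases hfin : (A.finalTapes 1).Finite
  · rcases hδ.eq_or_lt with rfl | hδpos
    · obtain ⟨s, T, hs, hT, Dec, hDec⟩ := A.exists_sketch_of_computes_zero hfin hg hA
      exact ⟨s, T, hs, fun i j => (hT i j).trans hpow, Dec, hexact hDec⟩
    · obtain ⟨F, hFD, hF⟩ := D.exists_finset_one_sub_le_sum hδpos
      have hFle : ∑ x ∈ F, (D x).toReal ≤ 1 := by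
        rw [← ENNReal.toReal_sum fun x _ => D.apply_ne_top x]
        refine ENNReal.toReal_le_of_le_ofReal zero_le_one ?_
        rw [ENNReal.ofReal_one, ← D.tsum_coe]
        exact ENNReal.sum_le_tsum F
      obtain ⟨s, T, hs, hT, Dec, hDec⟩ := A.exists_sketch_of_computes hfin hg hA
        (fun x => (D x).toReal) (fun x => ENNReal.toReal_nonneg) F hFle fun x hx => hD x (hFD x hx)
      refine ⟨s, T, hs, fun i j => (hT i j).trans hpow, Dec, ?_⟩
      let G := F.filter fun x => some (Dec (T.mulVec x)) = g x
      have hsplit := Finset.sum_filter_add_sum_filter_not F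
        (fun x => some (Dec (T.mulVec x)) = g x) fun x => (D x).toReal
      have hG : D.toMeasure.real (G : Set (Fin n → ℤ)) = ∑ x ∈ G, (D x).toReal := by
        rw [MeasureTheory.measureReal_def, PMF.toMeasure_apply_finset,
          ENNReal.toReal_sum fun x _ => D.apply_ne_top x]
      have hmono : D.toMeasure.real (G : Set (Fin n → ℤ)) ≤
          D.toMeasure.real {x | some (Dec (T.mulVec x)) = g x} :=
        MeasureTheory.measureReal_mono fun x hx => (Finset.mem_filter.1 hx).2
      linarith
  -- Without a bound on the space, the identity matrix is a sketch.
  · have hDec (x : Fin n → ℤ) (hx : g x ≠ none) :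
        some ((g ((1 : Matrix (Fin n) (Fin n) ℤ).mulVec x)).getD false) = g x := by
      obtain ⟨b, hb⟩ := Option.ne_none_iff_exists'.1 hx
      rw [Matrix.one_mulVec, hb, Option.getD_some]
    refine ⟨n, 1, ?_, fun i j => ?_, fun t => (g t).getD false,
      hexact (T := 1) (Dec := fun t => (g t).getD false) hDec⟩
    · simp [StreamingAlgorithm.space, hfin]
    · have hn : (1 : ℝ) ≤ n := by exact_mod_cast i.pos
      have : (1 : ℝ) ≤ (n : ℝ) ^ ((n : ℝ) / 2) := Real.one_le_rpow hn (by positivity)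
      rw [Matrix.one_apply]
      split_ifs
      · simpa using this.trans hpow
      · simpa using zero_le_one.trans (this.trans hpow)
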